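/- Let $(\mathcal D,K)$ and $(\mathcal C,J)$ be small sites and let $p:\mathcal D\to\mathcal C$ be a comorphism of sites, i.e. for every $J$-covering sieve $S$ on an object $p(d)$ there is a $K$-covering sieve $S'$ on $d$ with $p(S')\subseteq S$. Write $\widehat{\mathcal D}_K$, $\widehat{\mathcal C}_J$ for the toposes of sheaves of sets, $a_K$ for sheafification, $l_K:\mathcal D\to\widehat{\mathcal D}_K$, $l_J:\mathcal C\to\widehat{\mathcal C}_J$ for the Yoneda embeddings followed by sheafification, and $C_p:\widehat{\mathcal D}_K\to\widehat{\mathcal C}_J$ for the geometric morphism with inverse image $C_p^*=a_K(-\circ p^{op})$. For a functor $q:\mathcal A\to\mathcal B$, an arrow $f:x'\to x$ of $\mathcal A$ is *cartesian* if for all $g:x''\to x$ and $h:q(x'')\to q(x')$ with $q(f)h=q(g)$ there is a unique $h':x''\to x'$ with $q(h')=h$ and $fh'=g$; the functor $q$ is a (Street) *fibration* if for every $f:b\to q(x)$ there are a cartesian arrow $\hat f:x'\to x$ and an isomorphism $\sigma:q(x')\simeq b$ with $q(\hat f)=f\sigma$. Let $\eta:\mathcal D\to(\widehat{\mathcal D}_K/C_p^*)$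 be the functor into the comma category of triples $(F,E,F\to C_p^*E)$ that sends $d$ to $(l_K(d),l_J(p(d)),l_K(d)\to C_p^*l_J(p(d)))$, the arrow being the sheafification of the map of presheaves $\mathcal D(-,d)\to l_J(p(d))\circ p^{op}$ that corresponds to the image of $1_{p(d)}$. An arrow $f$ of $\mathcal D$ is *locally cartesian* if $\eta(f)$ is cartesian for the projection $(\widehat{\mathcal D}_K/C_p^*)\to\widehat{\mathcal C}_J$, $(F,E,\alpha)\mapsto E$. The comorphism $p$ is a *local fibration* if for every arrow $f:c\to p(d)$ of $\mathcal C$ there are a $J$-covering family $(f_i:p(d_i)\to c)_i$ and locally cartesian arrows $\hat f_i:d_i\to d$ with $f\circ f_i=p(\hat f_i)$. Assume that $p$ is a local fibration and that $p$ is continuous, i.e. $E\circ p^{op}$ is a $K$-sheaf for every $J$-sheaf $E$. Let $\mathbf{Sh}(p)^*:\widehat{\mathcal D}_K\to\widehat{\mathcal C}_J$ be the left adjoint of $-\circ p^{op}:\widehat{\mathcal C}_J\to\widehat{\mathcal D}_K$. Then: 1. $C_p$ is locally connected: $C_p^*$ has a left adjoint $C_{p!}$, and for every arrow $h:E'\to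 E$ of $\widehat{\mathcal C}_J$ the canonical transformation (the Beck–Chevalley transformation) comparing the two composites $\widehat{\mathcal D}_K/C_p^*E\to\widehat{\mathcal C}_J/E'$, "pull back along $C_p^*h$, then transpose" and "transpose, then pull back along $h$", is an isomorphism; here "transpose" sends $F\to C_p^*E$ to $C_{p!}F\to E$. 2. $\mathbf{Sh}(p)^*$ is a left adjoint of $C_p^*$, i.e. $\mathbf{Sh}(p)^*\simeq C_{p!}$, and this essential image $C_{p!}$ (any left adjoint of $C_p^*$) is a fibration. -/

import Mathlib

open CategoryTheory CategoryTheory.Limits Opposite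

universe w₁ w₂ t₁ t₂ v u

namespace RelTopos

/-! ### Cartesian arrows and (Street) fibrations -/

section Fibrations

variable {A : Type t₁} [Category.{w₁} A] {B : Type t₂} [Category.{w₂} B]

/-- An arrow `f : d' ⟶ d` is cartesian for `q` when for every `g : d'' ⟶ d` and every
`h : q d'' ⟶ q d'` with `h ≫ q f = q g` there is a unique `h' : d'' ⟶ d'` with `q h' = h` and
`h' ≫ f = g`. This is Mathlib's notion of a strongly cartesian arrow over `q f`. -/
abbrev IsCartesianArrow (q : A ⥤ B) {d' d : A} (f : d' ⟶ d) : Prop :=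
  q.IsStronglyCartesian (q.map f) f

/-- A (Street) fibration: every arrow `f : c ⟶ q d` has, up to an isomorphism `σ : q d' ≅ c`,
a cartesian lifting `d' ⟶ d`. -/
def IsStreetFibration (q : A ⥤ B) : Prop :=
  ∀ ⦃c : B⦄ ⦃d : A⦄ (f : c ⟶ q.obj d),
    ∃ (d' : A) (f' : d' ⟶ d) (σ : q.obj d' ≅ c),
      q.map f' = σ.hom ≫ f ∧ IsCartesianArrow q f'

end Fibrations

/-! ### Geometric morphisms, locally connected geometric morphisms -/

section Geometric

variable {F : Type t₁} [Category.{w₁} F] {E : Type t₂} [Category.{w₂} E]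

/-- A geometric morphism `F ⟶ E`: an adjunction whose left adjoint preserves finite limits. -/
structure GeomMorphism (F : Type t₁) [Category.{w₁} F] (E : Type t₂) [Category.{w₂} E] where
  /-- The inverse image functor. -/
  inverseImage : E ⥤ F
  /-- The direct image functor. -/
  directImage : F ⥤ E
  /-- The inverse image is left adjoint to the direct image. -/
  adj : inverseImage ⊣ directImage
  /-- The inverse image preserves finite limits. -/
  preservesFiniteLimits : PreservesFiniteLimits inverseImage

/-- For an adjunction `L ⊣ R` and an object `X` of the codomain of `L`, the functor on slices
sending `α : Y ⟶ R X` to its transpose `L Y ⟶ X`. -/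
@[simps]
def sliceTranspose {L : F ⥤ E} {R : E ⥤ F} (adj : L ⊣ R) (X : E) :
    Over (R.obj X) ⥤ Over X where
  obj α := Over.mk (L.map α.hom ≫ adj.counit.app X)
  map k := Over.homMk (L.map k.left) (by
    dsimp
    rw [← Category.assoc, ← L.map_comp, Over.w])

/-- For an adjunction `L ⊣ R`, an arrow `α : Y ⟶ R X` with transpose `L Y ⟶ X` and an arrow
`h : X' ⟶ X`, the canonical arrow from `L (Y ×_{R X} R X')` to `L Y ×_X X'`. -/
noncomputable def pullbackComparison [HasPullbacks F] [HasPullbacks E]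
    {L : F ⥤ E} {R : E ⥤ F} (adj : L ⊣ R) {X' X : E} (h : X' ⟶ X) {Y : F} (α : Y ⟶ R.obj X) :
    L.obj (pullback α (R.map h)) ⟶ pullback (L.map α ≫ adj.counit.app X) h :=
  pullback.lift
    (L.map (pullback.fst α (R.map h)))
    (L.map (pullback.snd α (R.map h)) ≫ adj.counit.app X')
    (by
      rw [← Category.assoc, ← L.map_comp, pullback.condition, L.map_comp, Category.assoc,
        Category.assoc]
      exact congrArg _ (adj.counit.naturality h))

theorem pullbackComparison_fst [HasPullbacks F] [HasPullbacks E]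
    {L : F ⥤ E} {R : E ⥤ F} (adj : L ⊣ R) {X' X : E} (h : X' ⟶ X) {Y : F} (α : Y ⟶ R.obj X) :
    pullbackComparison adj h α ≫ pullback.fst (L.map α ≫ adj.counit.app X) h =
      L.map (pullback.fst α (R.map h)) :=
  pullback.lift_fst _ _ _

theorem pullbackComparison_snd [HasPullbacks F] [HasPullbacks E]
    {L : F ⥤ E} {R : E ⥤ F} (adj : L ⊣ R) {X' X : E} (h : X' ⟶ X) {Y : F} (α : Y ⟶ R.obj X) :
    pullbackComparison adj h α ≫ pullback.snd (L.map α ≫ adj.counit.app X) h =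
      L.map (pullback.snd α (R.map h)) ≫ adj.counit.app X' :=
  pullback.lift_snd _ _ _

theorem pullbackComparison_naturality [HasPullbacks F] [HasPullbacks E]
    {L : F ⥤ E} {R : E ⥤ F} (adj : L ⊣ R) {X' X : E} (h : X' ⟶ X) {Y Z : F}
    (α : Y ⟶ R.obj X) (β : Z ⟶ R.obj X) (k : Y ⟶ Z)
    (e₁ : (pullback.fst α (R.map h) ≫ k) ≫ β = pullback.snd α (R.map h) ≫ R.map h)
    (e₂ : (pullback.fst (L.map α ≫ adj.counit.app X) h ≫ L.map k) ≫
      L.map β ≫ adj.counit.app X = pullback.snd (L.map α ≫ adj.counit.app X) h ≫ h) :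
    L.map (pullback.lift (pullback.fst α (R.map h) ≫ k) (pullback.snd α (R.map h)) e₁) ≫
        pullbackComparison adj h β =
      pullbackComparison adj h α ≫
        pullback.lift (pullback.fst (L.map α ≫ adj.counit.app X) h ≫ L.map k)
          (pullback.snd (L.map α ≫ adj.counit.app X) h) e₂ := by
  apply pullback.hom_ext
  · rw [Category.assoc, Category.assoc, pullback.lift_fst, pullbackComparison_fst,
      ← Category.assoc, pullbackComparison_fst, ← L.map_comp, ← L.map_comp, pullback.lift_fst]
  · rw [Category.assoc, Category.assoc, pullback.lift_snd, pullbackComparison_snd,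
      pullbackComparison_snd, ← Category.assoc, ← L.map_comp, pullback.lift_snd]

/-- For an adjunction `L ⊣ R` and `h : X' ⟶ X`, the canonical comparison transformation (the
Beck-Chevalley transformation) of the square
```
Over (R X) --(R h)^*--> Over (R X')
    |                       |
    v                       v
 Over X  ------h^*----->  Over X'
```
whose vertical functors are the functors `sliceTranspose` and whose horizontal ones are
pullback functors. -/
noncomputable def sliceComparison [HasPullbacks F] [HasPullbacks E]
    {L : F ⥤ E} {R : E ⥤ F} (adj : L ⊣ R) {X' X : E} (h : X' ⟶ X) :
    Over.pullback (R.map h) ⋙ sliceTranspose adj X' ⟶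
      sliceTranspose adj X ⋙ Over.pullback h where
  app α := Over.homMk (pullbackComparison adj h α.hom) (pullbackComparison_snd adj h α.hom)
  naturality α β k := by
    ext
    exact pullbackComparison_naturality adj h α.hom β.hom k.left _ _

/-- A geometric morphism is locally connected when it is essential, i.e. its inverse image has a
further left adjoint `f_!`, and the functors `F / f^* X ⥤ E / X` induced by `f_!` by transposition
commute with the pullback functors, i.e. they form an indexed functor between the canonical
indexed categories `X ↦ F / f^* X` and `X ↦ E / X`. -/
def GeomMorphism.IsLocallyConnected [HasPullbacks F] [HasPullbacks E]
    (f : GeomMorphism F E) : Prop :=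
  ∃ (shriek : F ⥤ E) (adj : shriek ⊣ f.inverseImage),
    ∀ ⦃X' X : E⦄ (h : X' ⟶ X), IsIso (sliceComparison adj h)

end Geometric

/-! ### Comorphisms of sites and local fibrations -/

section Sites

variable {C : Type u} [Category.{v} C] {D : Type u} [Category.{v} D]

/-- The topos of sheaves of sets on a small site. -/
abbrev Sh (J : GrothendieckTopology C) := Sheaf J (Type (max u v))

/-- The canonical functor from a site to its topos of sheaves: Yoneda, then sheafification. -/
noncomputable def canonicalFunctor (J : GrothendieckTopology C) : C ⥤ Sh J :=
  uliftYoneda.{u} ⋙ presheafToSheaf J (Type (max u v))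

variable (p : D ⥤ C) (K : GrothendieckTopology D) (J : GrothendieckTopology C)

/-- The functor `E ↦ a_K (E ∘ p^op)` from sheaves on the base to sheaves on the domain. -/
noncomputable def comorphismInverseImage : Sh J ⥤ Sh K :=
  sheafToPresheaf J (Type (max u v)) ⋙ (Functor.whiskeringLeft _ _ _).obj p.op ⋙
    presheafToSheaf K (Type (max u v))

/-- The adjunction between the inverse image of a comorphism of sites and the restriction to
sheaves of the right Kan extension along `p^op`. -/
noncomputable def comorphismAdjunction [p.IsCocontinuous K J] :
    comorphismInverseImage p K J ⊣ p.sheafPushforwardCocontinuous (Type (max u v)) K J :=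
  ((p.op.ranAdjunction (Type (max u v))).comp
    (Adjunction.id (C := Dᵒᵖ ⥤ Type (max u v)))).comp (sheafificationAdjunction K _)
    |>.restrictFullyFaithful (fullyFaithfulSheafToPresheaf J _) (Functor.FullyFaithful.id _)
      (Iso.refl _) (Iso.refl _)

/-- The geometric morphism `C_p : Sh(D, K) ⟶ Sh(C, J)` induced by a comorphism of sites
(a cocontinuous functor, in Mathlib's terminology) `p : (D, K) ⟶ (C, J)`. -/
noncomputable def comorphismGeom [p.IsCocontinuous K J] : GeomMorphism (Sh K) (Sh J) where
  inverseImage := comorphismInverseImage p K J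
  directImage := p.sheafPushforwardCocontinuous (Type (max u v)) K J
  adj := comorphismAdjunction p K J
  preservesFiniteLimits := by
    unfold comorphismInverseImage
    infer_instance

/-- The category underlying the canonical relative site of `C_p`: the comma category
`(Sh(D, K) / C_p^*)` of triples `(F, E, F ⟶ C_p^* E)`. -/
abbrev CanonicalStack := Comma (𝟭 (Sh K)) (comorphismInverseImage p K J)

/-- The structural projection `(F, E, α) ↦ E` of the canonical relative site. -/
noncomputable abbrev canonicalStackProj : CanonicalStack p K J ⥤ Sh J :=
  Comma.snd (𝟭 (Sh K)) (comorphismInverseImage p K J)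

/-- The map of presheaves `y d ⟶ y (p d) ∘ p^op` corresponding, by the Yoneda lemma, to the
identity of `p d`. -/
def evIdentity (d : D) :
    uliftYoneda.{u}.obj d ⟶ p.op ⋙ uliftYoneda.{u}.obj (p.obj d) :=
  uliftYonedaEquiv.symm ⟨𝟙 (p.obj d)⟩

/-- The composite of `y d ⟶ y (p d) ∘ p^op` with the sheafification map
`y (p d) ∘ p^op ⟶ l_J (p d) ∘ p^op`. -/
noncomputable def etaPresheaf (d : D) :
    uliftYoneda.{u}.obj d ⟶ p.op ⋙ ((canonicalFunctor J).obj (p.obj d)).obj :=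
  evIdentity p d ≫ Functor.whiskerLeft p.op (toSheafify J (uliftYoneda.{u}.obj (p.obj d)))

theorem evIdentity_naturality {d' d : D} (f : d' ⟶ d) :
    uliftYoneda.{u}.map f ≫ evIdentity p d =
      evIdentity p d' ≫ Functor.whiskerLeft p.op (uliftYoneda.{u}.map (p.map f)) := by
  ext X g
  simp [evIdentity, uliftYonedaEquiv]

theorem etaPresheaf_naturality {d' d : D} (f : d' ⟶ d) :
    uliftYoneda.{u}.map f ≫ etaPresheaf p J d =
      etaPresheaf p J d' ≫ Functor.whiskerLeft p.op ((canonicalFunctor J).map (p.map f)).hom := by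
  unfold etaPresheaf
  rw [← Category.assoc, evIdentity_naturality, Category.assoc, Category.assoc]
  congr 1
  exact congrArg (Functor.whiskerLeft p.op)
    (toSheafify_naturality J (uliftYoneda.{u}.map (p.map f)))

theorem eta_naturality {d' d : D} (f : d' ⟶ d) :
    (canonicalFunctor K).map f ≫
        (presheafToSheaf K (Type (max u v))).map (etaPresheaf p J d) =
      (presheafToSheaf K (Type (max u v))).map (etaPresheaf p J d') ≫
        (comorphismInverseImage p K J).map ((canonicalFunctor J).map (p.map f)) := by
  refine ((presheafToSheaf K (Type (max u v))).map_comp _ _).symm.trans ?_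
  rw [etaPresheaf_naturality]
  exact (presheafToSheaf K (Type (max u v))).map_comp _ _

/-- The canonical functor `η : D ⥤ (Sh(D, K) / C_p^*)`, sending `d` to
`(l_K d, l_J (p d), l_K d ⟶ C_p^* (l_J (p d)))` and `f` to `(l_K f, l_J (p f))`. -/
noncomputable def eta : D ⥤ CanonicalStack p K J where
  obj d :=
    { left := (canonicalFunctor K).obj d
      right := (canonicalFunctor J).obj (p.obj d)
      hom := (presheafToSheaf K (Type (max u v))).map (etaPresheaf p J d) }
  map f :=
    { left := (canonicalFunctor K).map f
      right := (canonicalFunctor J).map (p.map f)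
      w := eta_naturality p K J f }
  map_id d := by ext <;> simp
  map_comp f g := by ext <;> simp

/-- An arrow of `D` is locally cartesian when `η` sends it to a cartesian arrow of the canonical
relative site. -/
def IsLocallyCartesian {d' d : D} (f : d' ⟶ d) : Prop :=
  IsCartesianArrow (canonicalStackProj p K J) ((eta p K J).map f)

/-- A local fibration: a comorphism of sites such that every arrow `f : c ⟶ p d` becomes, after
composition with the arrows of some `J`-covering family `p dᵢ ⟶ c`, the image of locally cartesian
arrows `dᵢ ⟶ d`. -/
class IsLocalFibration : Prop extends p.IsCocontinuous K J where
  /-- Arrows lift locally to locally cartesian arrows. -/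
  exists_lift : ∀ ⦃c : C⦄ ⦃d : D⦄ (f : c ⟶ p.obj d),
    ∃ (ι : Type (max u v)) (d' : ι → D) (g : ∀ i, p.obj (d' i) ⟶ c) (f' : ∀ i, d' i ⟶ d),
      Sieve.ofArrows (fun i => p.obj (d' i)) g ∈ J c ∧
        ∀ i, g i ≫ f = p.map (f' i) ∧ IsLocallyCartesian p K J (f' i)

end Sites

end RelTopos

/-! Write `R` for restriction of sheaves along `p`. Continuity identifies `C_p^*` with `R`, so the
left adjoint `L` of `R` is also left adjoint to `C_p^*`. The content is the Beck–Chevalley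
condition: for `Y ⟶ R X` and `h : X' ⟶ X`, the arrow `κ : L (Y ×_{R X} R X') ⟶ L Y ×_X X'` is
invertible.

By Yoneda it suffices that composition with `κ` is bijective on arrows into every sheaf `Z`. Let `H`
be the local exponential: a section over `c` is a section of `X` over `c` together with a natural
map to `Z` from the sections of `X'` above its restrictions. Arrows `L Y ×_X X' ⟶ Z` are arrows `L Y
⟶ H` over `X`, hence by adjunction arrows `Y ⟶ R H` over `R X`. Such an arrow gives each section of
`Y` over `d` a family indexed by all arrows `c ⟶ p d`, whereas an arrow `Y ×_{R X} R X' ⟶ Z ∘ p`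
gives only a family indexed by arrows `x ⟶ d`.

The two kinds of family agree because `p` is a local fibration. Every `c ⟶ p d` is locally the image
of an arrow of `D`, which gives uniqueness (`SliceHom.ext_of_comp`). The lifts can be chosen locally
cartesian, so comparisons between them lift to `D` locally (`IsLocallyCartesian.exists_local_lift`),
which makes the local values glue (`SliceHom.exists_extension`).

The fibration property is then formal: Beck–Chevalley applied to the unit `d ⟶ R (L d)` produces the
liftings. -/

namespace RelTopos

/-! ### Local lifting through locally cartesian arrows -/

section Lift

variable {C : Type u} [Category.{v} C] {D : Type u} [Category.{v} D]

/-- Only existence of the lift is retained: later comparisons need some lift on a cover, never a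
unique one. -/
theorem comma_snd_exists_lift {A : Type t₁} [Category.{w₁} A] {B : Type t₂} [Category.{w₂} B]
    {R : B ⥤ A} {X Y Z : Comma (𝟭 A) R} (f : X ⟶ Y)
    (hf : IsCartesianArrow (Comma.snd (𝟭 A) R) f) (g : Z ⟶ Y) (h : Z.right ⟶ X.right)
    (w : h ≫ f.right = g.right) :
    ∃ χ : Z ⟶ X, χ.right = h ∧ χ ≫ f = g := by
  obtain ⟨χ, ⟨hχ, hχ'⟩, -⟩ := hf.universal_property (Comma.snd (𝟭 A) R)
    ((Comma.snd (𝟭 A) R).map f) f h ((Comma.snd (𝟭 A) R).map g) w.symm g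
  exact ⟨χ, (IsHomLift.eq_of_isHomLift (Comma.snd (𝟭 A) R) h χ).symm, hχ'⟩

/-- Two sections of a presheaf with the same image in the sheafification agree locally. -/
theorem toSheafify_eq_imp (J : GrothendieckTopology C) {P : Cᵒᵖ ⥤ Type (max u v)} {c : C}
    {x y : ToType (P.obj (op c))}
    (h : (toSheafify J P).app (op c) x = (toSheafify J P).app (op c) y) :
    Presheaf.equalizerSieve (X := op c) x y ∈ J c :=
  Presheaf.equalizerSieve_mem J (toSheafify J P) x y h

theorem etaPresheaf_app (p : D ⥤ C) (J : GrothendieckTopology C) {x d : D} (k : x ⟶ d) :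
    (etaPresheaf p J d).app (op x) ⟨k⟩ =
      (toSheafify J (uliftYoneda.{u}.obj (p.obj d))).app (op (p.obj x)) ⟨p.map k⟩ := by
  have : (evIdentity p d).app (op x) ⟨k⟩ = ⟨p.map k⟩ := by
    simp [evIdentity, uliftYonedaEquiv]
  exact congrArg _ this

theorem toSheafify_map_app (J : GrothendieckTopology C) {P Q : Cᵒᵖ ⥤ Type (max u v)} (f : P ⟶ Q)
    (X : Cᵒᵖ) (x : P.obj X) :
    ((presheafToSheaf J _).map f).hom.app X ((toSheafify J P).app X x) =
      (toSheafify J Q).app X (f.app X x) :=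
  (ConcreteCategory.congr_hom (congr_app (toSheafify_naturality J f) X) x).symm

variable {p : D ⥤ C} {K : GrothendieckTopology D} {J : GrothendieckTopology C}

variable (p) in
/-- The sieve of arrows `k : y ⟶ x` for which `k ≫ a` lifts through `f : d' ⟶ d` over the
arrow `p y ⟶ p x ⟶ p d'`. -/
def localLiftSieve {d' d x : D} (f : d' ⟶ d) (a : x ⟶ d) (w : p.obj x ⟶ p.obj d') : Sieve x where
  arrows y k := ∃ t : y ⟶ d', t ≫ f = k ≫ a ∧ p.map t = p.map k ≫ w
  downward_closed := by
    rintro y z k ⟨t, h₁, h₂⟩ m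
    exact ⟨m ≫ t, by simp [h₁], by simp [h₂]⟩

/-- Lifting through a locally cartesian arrow is possible locally. -/
theorem IsLocallyCartesian.exists_local_lift [p.IsCocontinuous K J] {d' d x : D} {f : d' ⟶ d}
    (hf : IsLocallyCartesian p K J f) (a : x ⟶ d) (w : p.obj x ⟶ p.obj d')
    (haw : w ≫ p.map f = p.map a) :
    localLiftSieve p f a w ∈ K x := by
  obtain ⟨χ, hχ, hχ'⟩ := comma_snd_exists_lift _ hf ((eta p K J).map a)
    ((canonicalFunctor J).map w)
    (((canonicalFunctor J).map_comp _ _).symm.trans (congrArg (canonicalFunctor J).map haw))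
  have hl : χ.left ≫ (canonicalFunctor K).map f = (canonicalFunctor K).map a :=
    congrArg CommaMorphism.left hχ'
  have hw : χ.left ≫ (presheafToSheaf K (Type (max u v))).map (etaPresheaf p J d') =
      (presheafToSheaf K (Type (max u v))).map (etaPresheaf p J x) ≫
        (comorphismInverseImage p K J).map ((canonicalFunctor J).map w) := by
    rw [← hχ]; exact χ.w
  -- By Yoneda, the lift `χ.left` amounts to a section of the sheafified representable of `d'` over
  -- `x`; locally it comes from genuine arrows `t : y ⟶ d'`.
  let s : ToType ((sheafify K (uliftYoneda.{u}.obj d')).obj (op x)) := χ.left.hom.app (op x) ((toSheafify K (uliftYoneda.{u}.obj x)).app (op x) ⟨𝟙 x⟩)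
  have hs : ∀ {y : D} (k : y ⟶ x), ((canonicalFunctor K).obj d').obj.map k.op s =
      χ.left.hom.app (op y) ((toSheafify K (uliftYoneda.{u}.obj x)).app (op y) ⟨k⟩) := by
    intro y k
    refine (NatTrans.naturality_apply χ.left.hom k.op _).symm.trans (congrArg _ ?_)
    refine (NatTrans.naturality_apply (toSheafify K (uliftYoneda.{u}.obj x)) k.op _).symm.trans
      (congrArg _ ?_)
    exact congrArg ULift.up (Category.comp_id k)
  refine K.transitive (Presheaf.imageSieve_mem K (toSheafify K (uliftYoneda.{u}.obj d')) s) _ ?_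
  rintro y k ⟨⟨t⟩, ht⟩
  replace ht := ht.trans (hs k)
  -- The two required equations on `t` are known only after sheafification, so each costs a
  -- refinement of the cover.
  have h₁ : (toSheafify K (uliftYoneda.{u}.obj d)).app (op y) ⟨t ≫ f⟩ =
      (toSheafify K (uliftYoneda.{u}.obj d)).app (op y) ⟨k ≫ a⟩ := by
    have e₁ := toSheafify_map_app K (uliftYoneda.{u}.map f) (op y) ⟨t⟩
    have e₂ := toSheafify_map_app K (uliftYoneda.{u}.map a) (op y) ⟨k⟩
    have e₃ := ConcreteCategory.congr_hom (congr_app (congrArg InducedCategory.Hom.hom hl) (op y))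
      ((toSheafify K (uliftYoneda.{u}.obj x)).app (op y) ⟨k⟩)
    refine e₁.symm.trans (Eq.trans ?_ e₂)
    exact (congrArg _ ht).trans e₃
  have h₂ : (toSheafify K (p.op ⋙ ((canonicalFunctor J).obj (p.obj d')).obj)).app (op y) ((etaPresheaf p J d').app (op y) ⟨t⟩) =
      (toSheafify K (p.op ⋙ ((canonicalFunctor J).obj (p.obj d')).obj)).app (op y)
        (((canonicalFunctor J).map w).hom.app (op (p.obj y))
          ((etaPresheaf p J x).app (op y) ⟨k⟩)) := by
    have e₁ := toSheafify_map_app K (etaPresheaf p J d') (op y) ⟨t⟩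
    have e₂ := toSheafify_map_app K (etaPresheaf p J x) (op y) ⟨k⟩
    have e₃ := ConcreteCategory.congr_hom (congr_app (congrArg InducedCategory.Hom.hom hw) (op y))
      ((toSheafify K (uliftYoneda.{u}.obj x)).app (op y) ⟨k⟩)
    have e₄ := toSheafify_map_app K (Functor.whiskerLeft p.op ((canonicalFunctor J).map w).hom)
      (op y) ((etaPresheaf p J x).app (op y) ⟨k⟩)
    refine e₁.symm.trans (Eq.trans ?_ e₄)
    refine (congrArg _ ht).trans (e₃.trans ?_)
    exact congrArg _ e₂
  refine K.transitive (K.intersection_covering (toSheafify_eq_imp K h₁)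
    (toSheafify_eq_imp K h₂)) _ ?_
  rintro z m ⟨hm₁, hm₂⟩
  replace hm₁ : (ULift.up (m ≫ t ≫ f) : ULift (z ⟶ d)) = ⟨m ≫ k ≫ a⟩ := hm₁
  have h₃ : (toSheafify J (uliftYoneda.{u}.obj (p.obj d'))).app (op (p.obj z)) ⟨p.map (m ≫ t)⟩ =
      (toSheafify J (uliftYoneda.{u}.obj (p.obj d'))).app (op (p.obj z))
        ⟨p.map (m ≫ k) ≫ w⟩ := by
    have e₁ := NatTrans.naturality_apply (etaPresheaf p J d') m.op ⟨t⟩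
    have e₂ := NatTrans.naturality_apply (etaPresheaf p J x ≫
      Functor.whiskerLeft p.op ((canonicalFunctor J).map w).hom) m.op ⟨k⟩
    have e₃ := toSheafify_map_app J (uliftYoneda.{u}.map w) (op (p.obj z)) ⟨p.map (m ≫ k)⟩
    refine (etaPresheaf_app p J (m ≫ t)).symm.trans (e₁.trans (Eq.trans hm₂ ?_))
    refine e₂.symm.trans (Eq.trans ?_ e₃)
    exact congrArg (((canonicalFunctor J).map w).hom.app (op (p.obj z)))
      (etaPresheaf_app p J (m ≫ k))
  -- The equation over the base holds only on a `J`-cover of `p z`; the comorphism property turns it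
  -- into a `K`-cover of `z`.
  refine K.superset_covering ?_ (p.cover_lift K J (toSheafify_eq_imp J h₃))
  intro z' n hn
  replace hn : (ULift.up (p.map n ≫ p.map (m ≫ t)) : ULift (_ ⟶ p.obj d')) =
    ⟨p.map n ≫ p.map (m ≫ k) ≫ w⟩ := hn
  refine ⟨n ≫ m ≫ t, ?_, ?_⟩
  -- The first equation already holds on the `K`-cover.
  · simpa using congrArg (n ≫ ·) (ULift.up_injective hm₁)
  · simpa using ULift.up_injective hn

end Lift

/-! ### The local exponential of sheaves -/

section SliceHom

variable {C : Type u} [Category.{v} C]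

theorem sheaf_eq_of_locally_eq {J : GrothendieckTopology C} {Z : Cᵒᵖ ⥤ Type w₁}
    (hZ : Presheaf.IsSheaf J Z) {c : C} {z z' : Z.obj (op c)} (S : Sieve c) (hS : S ∈ J c)
    (h : ∀ ⦃b : C⦄ (k : b ⟶ c), S k → Z.map k.op z = Z.map k.op z') : z = z' :=
  (hZ.isSheafFor S hS).isSeparatedFor.ext fun _ k hk ↦ h k hk

/-- Sections of a sheaf satisfying a predicate that is stable under restriction and has at most
one solution glue. -/
theorem sheaf_exists_of_locally_exists {J : GrothendieckTopology C} {Z : Cᵒᵖ ⥤ Type w₁}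
    (hZ : Presheaf.IsSheaf J Z) {c : C} (Q : ∀ ⦃b : C⦄, (b ⟶ c) → Z.obj (op b) → Prop)
    (hres : ∀ ⦃b b' : C⦄ (k : b ⟶ c) (m : b' ⟶ b) (z : Z.obj (op b)),
      Q k z → Q (m ≫ k) (Z.map m.op z))
    (huniq : ∀ ⦃b : C⦄ (k : b ⟶ c) (z z' : Z.obj (op b)), Q k z → Q k z' → z = z')
    (S : Sieve c) (hS : S ∈ J c)
    (hex : ∀ ⦃b : C⦄ (k : b ⟶ c), S k → ∃ z, Q k z) :
    ∃ z : Z.obj (op c), ∀ ⦃b : C⦄ (k : b ⟶ c), S k → Q k (Z.map k.op z) := by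
  choose f hf using hex
  let x : Presieve.FamilyOfElements Z S.arrows := fun b k hk ↦ f k hk
  have hx : x.Compatible := by
    rw [Presieve.compatible_iff_sieveCompatible]
    intro b b' k m hk
    exact huniq _ _ _ (hf _ _) (hres _ _ _ (hf k hk))
  obtain ⟨z, hz, -⟩ := hZ.isSheafFor S hS x hx
  refine ⟨z, fun b k hk ↦ ?_⟩
  rw [hz k hk]
  exact hf k hk

variable {E E' : Cᵒᵖ ⥤ Type (max u v)}

/-- A section over `c` of the local exponential of `h : E' ⟶ E` and `Z`: a section `base` of `E`
together with a natural family sending the sections of `E'` above restrictions of `base` to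
sections of `Z`. -/
structure SliceHom (h : E' ⟶ E) (Z : Cᵒᵖ ⥤ Type (max u v)) (c : C) : Type (max u v) where
  /-- The underlying section of the base. -/
  base : E.obj (op c)
  /-- The values of the family. -/
  app : ∀ ⦃b : C⦄ (v : b ⟶ c) (e : E'.obj (op b)),
    h.app (op b) e = E.map v.op base → Z.obj (op b)
  naturality : ∀ ⦃b b' : C⦄ (k : b' ⟶ b) (v : b ⟶ c) (e : E'.obj (op b))
    (he : h.app (op b) e = E.map v.op base)
    (he' : h.app (op b') (E'.map k.op e) = E.map (k ≫ v).op base),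
    app (k ≫ v) (E'.map k.op e) he' = Z.map k.op (app v e he)

theorem app_map_eq {h : E' ⟶ E} {b b' c : C} (k : b' ⟶ b) {v : b ⟶ c} {e : E'.obj (op b)}
    {a : E.obj (op c)} (he : h.app (op b) e = E.map v.op a) :
    h.app (op b') (E'.map k.op e) = E.map (k ≫ v).op a := by
  rw [NatTrans.naturality_apply, he, op_comp, Functor.map_comp_apply]

namespace SliceHom

variable {h : E' ⟶ E} {Z : Cᵒᵖ ⥤ Type (max u v)} {c : C}

theorem ext' {σ τ : SliceHom h Z c} (hb : σ.base = τ.base)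
    (ha : ∀ ⦃b : C⦄ (v : b ⟶ c) (e : E'.obj (op b)) (he : h.app (op b) e = E.map v.op σ.base)
      (he' : h.app (op b) e = E.map v.op τ.base), σ.app v e he = τ.app v e he') : σ = τ := by
  obtain ⟨a, f, _⟩ := σ
  obtain ⟨a', f', _⟩ := τ
  obtain rfl : a = a' := hb
  congr 1
  funext b v e he
  exact ha v e he he

theorem app_congr (σ : SliceHom h Z c) {b : C} {v v' : b ⟶ c} {e e' : E'.obj (op b)}
    (hv : v = v') (he : e = e') (h₁ : h.app (op b) e = E.map v.op σ.base)
    (h₂ : h.app (op b) e' = E.map v'.op σ.base) : σ.app v e h₁ = σ.app v' e' h₂ := by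
  subst hv he
  rfl

theorem congr_app {σ τ : SliceHom h Z c} (hστ : σ = τ) {b : C} (v : b ⟶ c) (e : E'.obj (op b))
    (h₁ : h.app (op b) e = E.map v.op σ.base) (h₂ : h.app (op b) e = E.map v.op τ.base) :
    σ.app v e h₁ = τ.app v e h₂ := by
  subst hστ
  rfl

/-- Restriction of sections of the local exponential. -/
def restrict (σ : SliceHom h Z c) {c' : C} (k : c' ⟶ c) : SliceHom h Z c' where
  base := E.map k.op σ.base
  app b v e he := σ.app (v ≫ k) e (he.trans (by simp))
  naturality b b' m v e he he' := by
    rw [← σ.naturality m (v ≫ k) e _ (he'.trans (by simp))]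
    exact σ.app_congr (Category.assoc _ _ _) rfl _ _

variable (h Z) in
/-- The local exponential, as a presheaf. -/
def presheaf : Cᵒᵖ ⥤ Type (max u v) where
  obj c := SliceHom h Z c.unop
  map k := TypeCat.ofHom fun σ ↦ σ.restrict k.unop
  map_id c := by
    ext σ
    exact ext' (by simp [restrict]) fun b v e _ _ ↦ σ.app_congr (Category.comp_id v) rfl _ _
  map_comp k l := by
    ext σ
    exact ext' (by simp [restrict])
      fun b v e _ _ ↦ σ.app_congr (Category.assoc v _ _).symm rfl _ _

/-- Bases glue because `E` is a sheaf. The value at `v` and `e` then glues because `Z` is a sheaf,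
along the covering sieve pulled back by `v`. -/
theorem isSheaf {J : GrothendieckTopology C} (hE : Presheaf.IsSheaf J E)
    (hZ : Presheaf.IsSheaf J Z) : Presheaf.IsSheaf J (presheaf h Z) := by
  rw [isSheaf_iff_isSheaf_of_type]
  intro c S hS x hx
  rw [Presieve.compatible_iff_sieveCompatible] at hx
  replace hx : ∀ ⦃b b' : C⦄ (k : b ⟶ c) (m : b' ⟶ b) (hk : S k),
    x (m ≫ k) (S.downward_closed hk m) = SliceHom.restrict (x k hk) m := fun b b' k m hk ↦ hx k m hk
  have x_congr : ∀ {b : C} {k k' : b ⟶ c} (hk : S k) (hk' : S k') (_ : k = k')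
      {e e' : E'.obj (op b)} (_ : e = e')
      (he : h.app (op b) e = E.map (𝟙 b : b ⟶ b).op (SliceHom.base (x k hk)))
      (he' : h.app (op b) e' = E.map (𝟙 b : b ⟶ b).op (SliceHom.base (x k' hk'))),
      SliceHom.app (x k hk) (𝟙 b) e he = SliceHom.app (x k' hk') (𝟙 b) e' he' := by
    rintro b k _ hk _ rfl e _ rfl _ _
    rfl
  -- By compatibility, all values of the local families can be read off at identity arrows.
  have x_app : ∀ {b b' : C} {k : b ⟶ c} (m : b' ⟶ b) (hk : S k) (hk' : S (m ≫ k))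
      (e : E'.obj (op b'))
      (he : h.app (op b') e = E.map (𝟙 b' : b' ⟶ b').op (SliceHom.base (x (m ≫ k) hk')))
      (he' : h.app (op b') e = E.map m.op (SliceHom.base (x k hk))),
      SliceHom.app (x (m ≫ k) hk') (𝟙 b') e he = SliceHom.app (x k hk) m e he' := by
    intro b b' k m hk hk' e he he'
    rw [SliceHom.congr_app (hx k m hk) (𝟙 b') e he (he'.trans (by simp [restrict]))]
    exact SliceHom.app_congr _ (Category.id_comp m) rfl _ _
  let xb : Presieve.FamilyOfElements E S.arrows := fun b k hk ↦ SliceHom.base (x k hk)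
  have hxb : xb.Compatible := by
    rw [Presieve.compatible_iff_sieveCompatible]
    intro b b' k m hk
    exact congrArg SliceHom.base (hx k m hk)
  obtain ⟨a, ha, -⟩ := hE.isSheafFor S hS xb hxb
  replace ha : ∀ ⦃b : C⦄ (k : b ⟶ c) (hk : S k), E.map k.op a = SliceHom.base (x k hk) := ha
  have base_eq : ∀ ⦃b b' : C⦄ (v : b ⟶ c) (k : b' ⟶ b) (hk : S (k ≫ v)) (e : E'.obj (op b)),
      h.app (op b) e = E.map v.op a → h.app (op b') (E'.map k.op e) =
        E.map (𝟙 b' : b' ⟶ b').op (SliceHom.base (x (k ≫ v) hk)) := by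
    intro b b' v k hk e he
    rw [op_id, Functor.map_id_apply, ← ha]
    exact app_map_eq k he
  have hex : ∀ ⦃b : C⦄ (v : b ⟶ c) (e : E'.obj (op b)) (he : h.app (op b) e = E.map v.op a),
      ∃ z : Z.obj (op b), ∀ ⦃b' : C⦄ (k : b' ⟶ b) (hk : S (k ≫ v)),
        Z.map k.op z =
          SliceHom.app (x (k ≫ v) hk) (𝟙 b') (E'.map k.op e) (base_eq v k hk e he) := by
    intro b v e he
    let y : Presieve.FamilyOfElements Z (S.pullback v).arrows := fun b' k hk ↦
      SliceHom.app (x (k ≫ v) hk) (𝟙 b') (E'.map k.op e) (base_eq v k hk e he)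
    have hy : y.Compatible := by
      rw [Presieve.compatible_iff_sieveCompatible]
      intro b' b'' k m hk
      have e₁ := (SliceHom.naturality (x (k ≫ v) hk) m (𝟙 b') (E'.map k.op e)
        (base_eq v k hk e he) (app_map_eq m (base_eq v k hk e he)))
      refine Eq.trans ?_ e₁
      have hk' : S (m ≫ k ≫ v) := S.downward_closed hk m
      have e₂ := app_map_eq m (base_eq v k hk e he)
      rw [Category.comp_id] at e₂
      refine Eq.trans ?_ ((x_app m hk hk' (E'.map m.op (E'.map k.op e)) ?_ e₂).trans
        (SliceHom.app_congr _ (Category.comp_id m).symm rfl _ _))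
      · exact x_congr _ _ (Category.assoc _ _ _) (by simp) _ _
      · rw [hx (k ≫ v) m hk]
        simpa [restrict] using e₂
    obtain ⟨z, hz, -⟩ := hZ.isSheafFor _ (J.pullback_stable v hS) y hy
    exact ⟨z, hz⟩
  choose f hf using hex
  refine ⟨⟨a, f, ?_⟩, ?_, ?_⟩
  · intro b b' k v e he he'
    refine sheaf_eq_of_locally_eq hZ _ (J.pullback_stable (k ≫ v) hS) fun b'' m hm ↦ ?_
    have hm' : S ((m ≫ k) ≫ v) := by simpa using hm
    refine (hf _ _ he' m hm).trans (Eq.trans ?_ ((hf v e he (m ≫ k) hm').symm.trans (by simp)))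
    exact x_congr _ _ (Category.assoc _ _ _).symm (by simp) _ _
  · intro b k hk
    refine ext' (ha k hk) fun b' v e he he' ↦ ?_
    -- As `v ≫ k` lies in `S`, the value glued over it can be read off at the identity of `b'`.
    have hk' : S (𝟙 b' ≫ v ≫ k) := by simpa using S.downward_closed hk v
    have e₀ : h.app (op b') e = E.map (v ≫ k).op a := by
      rw [he', ← ha k hk, ← Functor.map_comp_apply, op_comp]
    have e₁ := (Z.map_id_apply (X := op b') (f (v ≫ k) e e₀)).symm.trans
      (hf (v ≫ k) e e₀ (𝟙 b') hk')
    have hk'' : S (v ≫ k) := S.downward_closed hk v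
    have e₂ : h.app (op b') e = E.map (𝟙 b' : b' ⟶ b').op (SliceHom.base (x (v ≫ k) hk'')) := by
      rw [op_id, Functor.map_id_apply, ← ha, e₀]
    refine e₁.trans (Eq.trans ?_ (x_app v hk hk'' e e₂ he'))
    exact x_congr _ _ (Category.id_comp _) (by simp) _ _
  · intro τ hτ
    replace hτ : ∀ ⦃b : C⦄ (k : b ⟶ c) (hk : S k), SliceHom.restrict τ k = x k hk := hτ
    have hb : SliceHom.base τ = a := by
      refine sheaf_eq_of_locally_eq hE S hS fun b k hk ↦ ?_
      rw [ha k hk, ← hτ k hk]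
      rfl
    refine ext' hb fun b v e he he' ↦ ?_
    refine sheaf_eq_of_locally_eq hZ _ (J.pullback_stable v hS) fun b' k hk ↦ ?_
    rw [hf v e he' k hk, ← SliceHom.naturality τ k v e he (app_map_eq k he)]
    have e₁ : h.app (op b') (E'.map k.op e) =
        E.map (𝟙 b' : b' ⟶ b').op (SliceHom.restrict τ (k ≫ v)).base := by
      rw [app_map_eq k he]
      simp [restrict]
    refine Eq.trans ?_ (SliceHom.congr_app (hτ (k ≫ v) hk) (𝟙 b') (E'.map k.op e) e₁ _)
    exact SliceHom.app_congr _ (Category.id_comp _).symm rfl _ _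

end SliceHom

end SliceHom

/-! ### Extending families from arrows of `D` to arrows of `C` -/

section Extension

variable {C : Type u} [Category.{v} C] {D : Type u} [Category.{v} D]
  {p : D ⥤ C} {K : GrothendieckTopology D} {J : GrothendieckTopology C}
  {E E' : Cᵒᵖ ⥤ Type (max u v)} {h : E' ⟶ E} {Z : Cᵒᵖ ⥤ Type (max u v)}

/-- Any `v : c ⟶ p d` becomes the image of an arrow of `D` on a cover of `c`, and the sheaf `Z`
detects equality there. Cartesianness of the lifts plays no role. -/
theorem SliceHom.ext_of_comp [IsLocalFibration p K J] (hZ : Presheaf.IsSheaf J Z) {d : D}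
    {σ τ : SliceHom h Z (p.obj d)} (hb : σ.base = τ.base)
    (ha : ∀ ⦃x : D⦄ (u : x ⟶ d) (e : E'.obj (op (p.obj x)))
      (he : h.app (op (p.obj x)) e = E.map (p.map u).op σ.base)
      (he' : h.app (op (p.obj x)) e = E.map (p.map u).op τ.base),
      σ.app (p.map u) e he = τ.app (p.map u) e he') : σ = τ := by
  refine SliceHom.ext' hb fun c v e he he' ↦ ?_
  obtain ⟨ι, d', g, f', hS, hg⟩ := IsLocalFibration.exists_lift (p := p) (K := K) (J := J) v
  refine sheaf_eq_of_locally_eq hZ _ hS ?_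
  rintro b _ ⟨_, m, _, ⟨i⟩, rfl⟩
  have key : Z.map (g i).op (σ.app v e he) = Z.map (g i).op (τ.app v e he') := by
    rw [← σ.naturality (g i) v e he (app_map_eq _ he),
      ← τ.naturality (g i) v e he' (app_map_eq _ he')]
    rw [σ.app_congr (hg i).1 rfl _ ((hg i).1 ▸ app_map_eq _ he),
      τ.app_congr (hg i).1 rfl _ ((hg i).1 ▸ app_map_eq _ he')]
    exact ha _ _ _ _
  rw [op_comp, Functor.map_comp_apply, Functor.map_comp_apply, key]

/-- A natural family of sections of `Z` over the arrows `x ⟶ d` extends to all arrows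
`c ⟶ p d`. -/
theorem SliceHom.exists_extension [IsLocalFibration p K J] (hZ : Presheaf.IsSheaf J Z)
    (hZp : Presheaf.IsSheaf K (p.op ⋙ Z)) {d : D} (a : E.obj (op (p.obj d)))
    (φ : ∀ ⦃x : D⦄ (u : x ⟶ d) (e : E'.obj (op (p.obj x))),
      h.app (op (p.obj x)) e = E.map (p.map u).op a → Z.obj (op (p.obj x)))
    (hφ : ∀ ⦃x y : D⦄ (k : y ⟶ x) (u : x ⟶ d) (e : E'.obj (op (p.obj x)))
      (he : h.app (op (p.obj x)) e = E.map (p.map u).op a)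
      (he' : h.app (op (p.obj y)) (E'.map (p.map k).op e) = E.map (p.map (k ≫ u)).op a),
      φ (k ≫ u) (E'.map (p.map k).op e) he' = Z.map (p.map k).op (φ u e he)) :
    ∃ σ : SliceHom h Z (p.obj d), σ.base = a ∧
      ∀ ⦃x : D⦄ (u : x ⟶ d) (e : E'.obj (op (p.obj x)))
        (he : h.app (op (p.obj x)) e = E.map (p.map u).op a)
        (he' : h.app (op (p.obj x)) e = E.map (p.map u).op σ.base),
        σ.app (p.map u) e he' = φ u e he := by
  have φ_congr : ∀ ⦃x : D⦄ {u u' : x ⟶ d} {e e' : E'.obj (op (p.obj x))} (hu : u = u')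
      (hee : e = e') (he : h.app (op (p.obj x)) e = E.map (p.map u).op a)
      (he' : h.app (op (p.obj x)) e' = E.map (p.map u').op a), φ u e he = φ u' e' he' := by
    rintro x u _ e _ rfl rfl _ _
    rfl
  -- `Q v e z` says that `z` is an admissible value at `(v, e)`: it restricts to the prescribed one
  -- along every `m : p x ⟶ c` for which `m ≫ v` comes from `D`.
  let Q : ∀ ⦃c : C⦄ (v : c ⟶ p.obj d) (e : E'.obj (op c)) (z : Z.obj (op c)), Prop :=
    fun c v e z ↦ ∀ ⦃x : D⦄ (m : p.obj x ⟶ c) (u : x ⟶ d) (_ : m ≫ v = p.map u)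
      (e' : E'.obj (op (p.obj x))) (_ : e' = E'.map m.op e)
      (he' : h.app (op (p.obj x)) e' = E.map (p.map u).op a), φ u e' he' = Z.map m.op z
  have Q_restrict : ∀ ⦃c c' : C⦄ (k : c' ⟶ c) (v : c ⟶ p.obj d) (e : E'.obj (op c))
      (z : Z.obj (op c)), Q v e z → Q (k ≫ v) (E'.map k.op e) (Z.map k.op z) := by
    intro c c' k v e z hz x m u hu e' he' heu
    rw [← Functor.map_comp_apply, ← op_comp]
    exact hz (m ≫ k) u (by simpa using hu) e' (by simp [he']) heu
  have Q_unique : ∀ ⦃c : C⦄ (v : c ⟶ p.obj d) (e : E'.obj (op c))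
      (_ : h.app (op c) e = E.map v.op a) (z z' : Z.obj (op c)), Q v e z → Q v e z' → z = z' := by
    intro c v e he z z' hz hz'
    obtain ⟨ι, d', g, f', hS, hg⟩ := IsLocalFibration.exists_lift (p := p) (K := K) (J := J) v
    refine sheaf_eq_of_locally_eq hZ _ hS ?_
    rintro b _ ⟨_, m, _, ⟨i⟩, rfl⟩
    have he' := app_map_eq (g i) he
    rw [(hg i).1] at he'
    rw [op_comp, Functor.map_comp_apply, Functor.map_comp_apply, ← hz (g i) (f' i) (hg i).1 _ rfl he',
      ← hz' (g i) (f' i) (hg i).1 _ rfl he']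
  have Q_local : ∀ ⦃c : C⦄ (v : c ⟶ p.obj d) (e : E'.obj (op c))
      (_ : h.app (op c) e = E.map v.op a) (z : Z.obj (op c)) (S : Sieve c) (_ : S ∈ J c),
      (∀ ⦃b : C⦄ (k : b ⟶ c), S k → Q (k ≫ v) (E'.map k.op e) (Z.map k.op z)) → Q v e z := by
    intro c v e he z S hS hz x m u hu e' he' heu
    -- Pulled back along `m`, the cover lifts to a `K`-cover of `x`, and `Z ∘ p` is a `K`-sheaf by
    -- hypothesis.
    refine sheaf_eq_of_locally_eq hZp _ (p.cover_lift K J (J.pullback_stable m hS)) ?_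
    intro y k hk
    have hk' : h.app (op (p.obj y)) (E'.map (p.map k).op e') =
        E.map (p.map (k ≫ u)).op a := by
      rw [p.map_comp]
      exact app_map_eq _ heu
    have h₂ := hz (p.map k ≫ m) hk (𝟙 _) (k ≫ u) (by simp [hu]) _ (by simp [he']) hk'
    refine (hφ k u e' heu hk').symm.trans (h₂.trans ?_)
    rw [op_id, Functor.map_id_apply, op_comp, Functor.map_comp_apply]
    rfl
  have Q_cartesian : ∀ ⦃d' : D⦄ (f : d' ⟶ d) (_ : IsLocallyCartesian p K J f)
      (e : E'.obj (op (p.obj d'))) (he : h.app (op (p.obj d')) e = E.map (p.map f).op a),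
      Q (p.map f) e (φ f e he) := by
    intro d' f hf e he x m u hu e' he' heu
    -- Locally on `x`, the arrow `m` is induced by an arrow `t` to `d'` with `t ≫ f = k ≫ u`, so
    -- naturality of `φ` along `t` and along `k` gives the equality.
    refine sheaf_eq_of_locally_eq hZp _ (hf.exists_local_lift u m hu) ?_
    rintro y k ⟨t, ht₁, ht₂⟩
    have hk' : h.app (op (p.obj y)) (E'.map (p.map k).op e') =
        E.map (p.map (k ≫ u)).op a := by
      rw [p.map_comp]
      exact app_map_eq _ heu
    have ht' : h.app (op (p.obj y)) (E'.map (p.map t).op e) = E.map (p.map (t ≫ f)).op a := by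
      rw [p.map_comp]
      exact app_map_eq _ he
    refine (hφ k u e' heu hk').symm.trans (Eq.trans ?_ ((hφ t f e he ht').trans ?_))
    · exact φ_congr ht₁.symm (by simp [he', ht₂]) _ _
    · rw [ht₂, op_comp, Functor.map_comp_apply]
      rfl
  have Q_exists : ∀ ⦃c : C⦄ (v : c ⟶ p.obj d) (e : E'.obj (op c))
      (_ : h.app (op c) e = E.map v.op a), ∃ z, Q v e z := by
    intro c v e he
    obtain ⟨ι, d', g, f', hS, hg⟩ := IsLocalFibration.exists_lift (p := p) (K := K) (J := J) v
    obtain ⟨z, hz⟩ := sheaf_exists_of_locally_exists hZ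
      (Q := fun b k z ↦ Q (k ≫ v) (E'.map k.op e) z) (by
        intro b b' k m z hz
        have := Q_restrict m _ _ _ hz
        rwa [← Functor.map_comp_apply, ← op_comp, ← Category.assoc] at this)
      (fun b k z z' ↦ Q_unique _ _ (app_map_eq k he) z z') _ hS (by
        rintro b _ ⟨_, m, _, ⟨i⟩, rfl⟩
        have he' := app_map_eq (g i) he
        rw [(hg i).1] at he'
        have := Q_restrict m _ _ _ (Q_cartesian _ (hg i).2 _ he')
        rw [← Functor.map_comp_apply, ← op_comp, ← (hg i).1, ← Category.assoc] at this
        exact ⟨_, this⟩)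
    -- The glued section is admissible on the cover, hence admissible.
    exact ⟨z, Q_local v e he z _ hS hz⟩
  choose ψ hψ using Q_exists
  refine ⟨⟨a, ψ, ?_⟩, rfl, ?_⟩
  · intro b b' k v e he he'
    exact Q_unique _ _ he' _ _ (hψ _ _ _) (Q_restrict _ _ _ _ (hψ _ _ _))
  · intro x u e he _
    exact (hψ (p.map u) e he (𝟙 _) u (by simp) e (by simp) he).symm ▸ by simp

end Extension

/-! ### The Beck–Chevalley condition for restriction along `p` -/

section BeckChevalley

theorem sheaf_ext_of_isPullback {C : Type u} [Category.{v} C] {J : GrothendieckTopology C}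
    {P X Y Z : Sh J} {fst : P ⟶ X} {snd : P ⟶ Y} {f : X ⟶ Z} {g : Y ⟶ Z}
    (sq : IsPullback fst snd f g) {c : C} {q q' : P.obj.obj (op c)}
    (h₁ : fst.hom.app (op c) q = fst.hom.app (op c) q')
    (h₂ : snd.hom.app (op c) q = snd.hom.app (op c) q') : q = q' :=
  Types.ext_of_isPullback (sq.map (sheafToPresheaf J _ ⋙ (evaluation _ _).obj (op c))) h₁ h₂

theorem sheaf_exists_of_isPullback {C : Type u} [Category.{v} C] {J : GrothendieckTopology C}
    {P X Y Z : Sh J} {fst : P ⟶ X} {snd : P ⟶ Y} {f : X ⟶ Z} {g : Y ⟶ Z}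
    (sq : IsPullback fst snd f g) {c : C} (x : X.obj.obj (op c)) (y : Y.obj.obj (op c))
    (h : f.hom.app (op c) x = g.hom.app (op c) y) :
    ∃ q : P.obj.obj (op c), fst.hom.app (op c) q = x ∧ snd.hom.app (op c) q = y :=
  Types.exists_of_isPullback (sq.map (sheafToPresheaf J _ ⋙ (evaluation _ _).obj (op c))) x y h

variable {C : Type u} [Category.{v} C] {D : Type u} [Category.{v} D]
  {p : D ⥤ C} {K : GrothendieckTopology D} {J : GrothendieckTopology C} [p.IsContinuous K J]
  {L : Sh K ⥤ Sh J} (adj : L ⊣ p.sheafPushforwardContinuous (Type (max u v)) K J)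

/-- The image of a section of `Y` under the unit of an adjunction whose right adjoint is
composition with `p`. -/
def unitSection {Y : Sh K} {d : D} (s : Y.obj.obj (op d)) :
    (L.obj Y).obj.obj (op (p.obj d)) :=
  (adj.unit.app Y).hom.app (op d) s

theorem unitSection_map {Y : Sh K} {d x : D} (u : x ⟶ d) (s : Y.obj.obj (op d)) :
    unitSection adj (Y.obj.map u.op s) = (L.obj Y).obj.map (p.map u).op (unitSection adj s) :=
  NatTrans.naturality_apply (adj.unit.app Y).hom u.op s

theorem map_unitSection {Y Y' : Sh K} (f : Y ⟶ Y') {d : D} (s : Y.obj.obj (op d)) :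
    (L.map f).hom.app (op (p.obj d)) (unitSection adj s) =
      unitSection adj (f.hom.app (op d) s) :=
  (ConcreteCategory.congr_hom (congr_app (congrArg InducedCategory.Hom.hom
    (adj.unit.naturality f)) (op d)) s).symm

theorem homEquiv_symm_unitSection {Y : Sh K} {X : Sh J}
    (α : Y ⟶ (p.sheafPushforwardContinuous (Type (max u v)) K J).obj X) {d : D}
    (s : Y.obj.obj (op d)) :
    ((adj.homEquiv Y X).symm α).hom.app (op (p.obj d)) (unitSection adj s) =
      α.hom.app (op d) s := by
  have := (adj.homEquiv Y X).apply_symm_apply α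
  rw [Adjunction.homEquiv_unit] at this
  exact ConcreteCategory.congr_hom (congr_app (congrArg InducedCategory.Hom.hom this) (op d)) s

/-- This is injectivity of transposition, read on sections: unit sections suffice to test arrows out
of `L Y`. -/
theorem hom_ext_unitSection {Y : Sh K} {X : Sh J} {f g : L.obj Y ⟶ X}
    (h : ∀ ⦃d : D⦄ (s : Y.obj.obj (op d)), f.hom.app (op (p.obj d)) (unitSection adj s) =
      g.hom.app (op (p.obj d)) (unitSection adj s)) : f = g := by
  apply (adj.homEquiv Y X).injective
  rw [Adjunction.homEquiv_unit, Adjunction.homEquiv_unit]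
  apply Sheaf.hom_ext
  ext d s
  exact h s

/-- The local exponential of sheaves. -/
def sliceHomSheaf {X X' : Sh J} (h : X' ⟶ X) (Z : Sh J) : Sh J :=
  ⟨SliceHom.presheaf h.hom Z.obj, SliceHom.isSheaf X.property Z.property⟩

/-- The projection of the local exponential to the base. -/
def sliceHomBase {X X' : Sh J} (h : X' ⟶ X) (Z : Sh J) : sliceHomSheaf h Z ⟶ X :=
  ⟨{ app := fun c ↦ TypeCat.ofHom fun σ ↦ SliceHom.base σ }⟩

section Square

variable {Y P : Sh K} {X X' Q : Sh J} {h : X' ⟶ X}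
  {α : Y ⟶ (p.sheafPushforwardContinuous (Type (max u v)) K J).obj X} {fst : P ⟶ Y}
  {snd : P ⟶ (p.sheafPushforwardContinuous (Type (max u v)) K J).obj X'}
  {a : Q ⟶ L.obj Y} {b : Q ⟶ X'} {κ : L.obj P ⟶ Q}

/-- Currying arrows out of a pullback. -/
theorem exists_curry {W : Sh J} {a : Q ⟶ W} {β : W ⟶ X} (sq : IsPullback a b β h) {Z : Sh J}
    (ψ : Q ⟶ Z) :
    ∃ m : W ⟶ sliceHomSheaf h Z, ∀ ⦃c : C⦄ (l : W.obj.obj (op c)),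
      SliceHom.base (m.hom.app (op c) l) = β.hom.app (op c) l ∧
      ∀ ⦃c' : C⦄ (v : c' ⟶ c) (q : Q.obj.obj (op c'))
        (_ : a.hom.app (op c') q = W.obj.map v.op l) he,
        SliceHom.app (m.hom.app (op c) l) v (b.hom.app (op c') q) he = ψ.hom.app (op c') q := by
  have hex : ∀ ⦃c : C⦄ (l : W.obj.obj (op c)) ⦃c' : C⦄ (v : c' ⟶ c) (e : X'.obj.obj (op c'))
      (he : h.hom.app (op c') e = X.obj.map v.op (β.hom.app (op c) l)),
      ∃ q : Q.obj.obj (op c'), a.hom.app (op c') q = W.obj.map v.op l ∧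
        b.hom.app (op c') q = e := fun c l c' v e he ↦
    sheaf_exists_of_isPullback sq _ _ ((NatTrans.naturality_apply β.hom v.op l).trans he.symm)
  choose mk hmk₁ hmk₂ using hex
  -- The choice of `mk` is harmless: a section of the pullback is determined by its two projections,
  -- which also yields naturality.
  let σ : ∀ ⦃c : C⦄ (l : W.obj.obj (op c)), SliceHom h.hom Z.obj c := fun c l ↦
    { base := β.hom.app (op c) l
      app := fun c' v e he ↦ ψ.hom.app (op c') (mk l v e he)
      naturality := by
        intro c' c'' k v e he he'
        rw [← NatTrans.naturality_apply]
        congr 1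
        apply sheaf_ext_of_isPullback sq
        · rw [hmk₁, NatTrans.naturality_apply, hmk₁, op_comp, Functor.map_comp_apply]
        · rw [hmk₂, NatTrans.naturality_apply, hmk₂] }
  have σ_map : ∀ ⦃c c' : C⦄ (k : c' ⟶ c) (l : W.obj.obj (op c)),
      σ (W.obj.map k.op l) = (σ l).restrict k := by
    intro c c' k l
    refine SliceHom.ext' (NatTrans.naturality_apply β.hom k.op l) fun c'' v e he he' ↦ ?_
    refine congrArg (ψ.hom.app (op c'')) (sheaf_ext_of_isPullback sq ?_ ?_)
    · exact (hmk₁ _ v e he).trans (Eq.trans (by simp) (hmk₁ l (v ≫ k) e _).symm)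
    · exact (hmk₂ _ v e he).trans (hmk₂ l (v ≫ k) e _).symm
  refine ⟨⟨{ app := fun c ↦ TypeCat.ofHom fun l ↦ σ l, naturality := fun c c' k ↦
    ConcreteCategory.hom_ext _ _ (σ_map k.unop) }⟩, ?_⟩
  · intro c l
    refine ⟨rfl, fun c' v q hq he ↦ ?_⟩
    refine congrArg (ψ.hom.app (op c')) ?_
    apply sheaf_ext_of_isPullback sq
    · rw [hmk₁, hq]
    · rw [hmk₂]

/-- Uncurrying arrows into the local exponential. -/
theorem exists_uncurry {W : Sh J} {a : Q ⟶ W} {β : W ⟶ X} (sq : IsPullback a b β h) {Z : Sh J}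
    (m : W ⟶ sliceHomSheaf h Z) (hm : m ≫ sliceHomBase h Z = β) :
    ∃ ψ : Q ⟶ Z, ∀ ⦃c : C⦄ (q : Q.obj.obj (op c)) he,
      ψ.hom.app (op c) q =
        SliceHom.app (m.hom.app (op c) (a.hom.app (op c) q)) (𝟙 c) (b.hom.app (op c) q) he := by
  have hb : ∀ ⦃c : C⦄ (q : Q.obj.obj (op c)), h.hom.app (op c) (b.hom.app (op c) q) =
      X.obj.map (𝟙 c : c ⟶ c).op (SliceHom.base (m.hom.app (op c) (a.hom.app (op c) q))) := by
    intro c q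
    rw [op_id, Functor.map_id_apply]
    have e₁ := ConcreteCategory.congr_hom (congr_app (congrArg InducedCategory.Hom.hom sq.w)
      (op c)) q
    have e₂ := ConcreteCategory.congr_hom (congr_app (congrArg InducedCategory.Hom.hom hm)
      (op c)) (a.hom.app (op c) q)
    exact e₁.symm.trans e₂.symm
  let f : Q.obj ⟶ Z.obj :=
    { app := fun c ↦ TypeCat.ofHom fun q ↦
        SliceHom.app (m.hom.app c (a.hom.app c q)) (𝟙 c.unop) (b.hom.app c q) (hb q)
      naturality := fun c c' k ↦ ConcreteCategory.hom_ext _ _ fun q ↦ ?_ }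
  · exact ⟨⟨f⟩, fun c q he ↦ rfl⟩
  have e₁ : m.hom.app c' (a.hom.app c' (Q.obj.map k q)) =
      SliceHom.restrict (m.hom.app c (a.hom.app c q)) k.unop := by
    rw [NatTrans.naturality_apply, NatTrans.naturality_apply]
    rfl
  have e₂ : b.hom.app c' (Q.obj.map k q) = X'.obj.map k (b.hom.app c q) :=
    NatTrans.naturality_apply _ _ _
  have e₃ := (app_map_eq k.unop (hb q))
  have e₄ := SliceHom.naturality (m.hom.app c (a.hom.app c q)) k.unop (𝟙 c.unop)
    (b.hom.app c q) (hb q) e₃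
  refine Eq.trans ?_ e₄
  refine (SliceHom.congr_app e₁ (𝟙 c'.unop) _ (hb _) ?_).trans ?_
  · rw [← e₁]
    exact hb _
  · exact SliceHom.app_congr _ ((Category.id_comp _).trans (Category.comp_id _).symm) e₂ _ _

theorem comparison_unitSection (hκ₁ : κ ≫ a = L.map fst)
    (hκ₂ : κ ≫ b = (adj.homEquiv P X').symm snd) {d : D} (q : P.obj.obj (op d)) :
    a.hom.app (op (p.obj d)) (κ.hom.app (op (p.obj d)) (unitSection adj q)) =
        unitSection adj (fst.hom.app (op d) q) ∧
      b.hom.app (op (p.obj d)) (κ.hom.app (op (p.obj d)) (unitSection adj q)) =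
        snd.hom.app (op d) q :=
  ⟨(ConcreteCategory.congr_hom (congr_app (congrArg InducedCategory.Hom.hom hκ₁) _) _).trans
      (map_unitSection adj fst q),
    (ConcreteCategory.congr_hom (congr_app (congrArg InducedCategory.Hom.hom hκ₂) _) _).trans
      (homEquiv_symm_unitSection adj snd q)⟩

/-- After currying, both arrows are tested on unit sections over objects `p d`, and there only at
arrows coming from `D`. The sections of `Q` met in this way all lie in the image of `κ`. -/
theorem comparison_comp_injective [IsLocalFibration p K J]
    (sq : IsPullback fst snd α ((p.sheafPushforwardContinuous (Type (max u v)) K J).map h))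
    (sq' : IsPullback a b ((adj.homEquiv Y X).symm α) h) (hκ₁ : κ ≫ a = L.map fst)
    (hκ₂ : κ ≫ b = (adj.homEquiv P X').symm snd) {Z : Sh J} {ψ ψ' : Q ⟶ Z}
    (hψ : κ ≫ ψ = κ ≫ ψ') : ψ = ψ' := by
  obtain ⟨m, hm⟩ := exists_curry sq' ψ
  obtain ⟨m', hm'⟩ := exists_curry sq' ψ'
  have hmm' : m = m' := by
    apply hom_ext_unitSection adj
    intro d s
    refine SliceHom.ext_of_comp (K := K) Z.property ((hm _).1.trans (hm' _).1.symm) ?_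
    intro x u e he he'
    obtain ⟨q, hq₁, hq₂⟩ := sheaf_exists_of_isPullback sq (Y.obj.map u.op s) e (by
      rw [(hm _).1, homEquiv_symm_unitSection] at he
      exact (NatTrans.naturality_apply α.hom u.op s).trans he.symm)
    obtain ⟨h₁, h₂⟩ := comparison_unitSection adj hκ₁ hκ₂ q
    rw [hq₁, unitSection_map] at h₁
    replace h₂ := h₂.trans hq₂
    subst h₂
    rw [(hm _).2 (p.map u) _ h₁, (hm' _).2 (p.map u) _ h₁]
    exact ConcreteCategory.congr_hom (congr_app (congrArg InducedCategory.Hom.hom hψ) _) _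
  subst hmm'
  apply Sheaf.hom_ext
  ext c q
  -- Evaluating the curried arrow at an identity recovers the original one.
  have hq : a.hom.app c q = (L.obj Y).obj.map (𝟙 c.unop).op (a.hom.app c q) := by simp
  have hb : h.hom.app c (b.hom.app c q) = X.obj.map (𝟙 c.unop).op
      (SliceHom.base (m.hom.app c (a.hom.app c q))) := by
    rw [(hm _).1, op_id, Functor.map_id_apply]
    exact (ConcreteCategory.congr_hom (congr_app (congrArg InducedCategory.Hom.hom sq'.w) c)
      q).symm
  exact ((hm _).2 (𝟙 _) q hq hb).symm.trans ((hm' _).2 (𝟙 _) q hq hb)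

/-- A section `s` of `Y` over `d` yields the family `(u, e) ↦ χ (u^* s, e)` over arrows `u : x ⟶ d`.
Its extensions to all arrows `c ⟶ p d` assemble into `Y ⟶ R H`, which is transposed and uncurried.
-/
theorem comparison_comp_surjective [IsLocalFibration p K J]
    (sq : IsPullback fst snd α ((p.sheafPushforwardContinuous (Type (max u v)) K J).map h))
    (sq' : IsPullback a b ((adj.homEquiv Y X).symm α) h) (hκ₁ : κ ≫ a = L.map fst)
    (hκ₂ : κ ≫ b = (adj.homEquiv P X').symm snd) {Z : Sh J} (χ : L.obj P ⟶ Z) :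
    ∃ ψ : Q ⟶ Z, κ ≫ ψ = χ := by
  have hex : ∀ ⦃d : D⦄ (s : Y.obj.obj (op d)) ⦃x : D⦄ (u : x ⟶ d) (e : X'.obj.obj (op (p.obj x)))
      (_ : h.hom.app (op (p.obj x)) e = X.obj.map (p.map u).op (α.hom.app (op d) s)),
      ∃ q : P.obj.obj (op x), fst.hom.app (op x) q = Y.obj.map u.op s ∧
        snd.hom.app (op x) q = e := fun d s x u e he ↦
    sheaf_exists_of_isPullback sq _ _ ((NatTrans.naturality_apply α.hom u.op s).trans he.symm)
  choose mk hmk₁ hmk₂ using hex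
  have hσ := fun (d : D) (s : Y.obj.obj (op d)) ↦
    SliceHom.exists_extension (p := p) (K := K) (J := J) (h := h.hom) (Z := Z.obj) Z.property
      (p.op_comp_isSheaf K J Z) (d := d) (α.hom.app (op d) s)
      (fun x u e he ↦ χ.hom.app (op (p.obj x)) (unitSection adj (mk s u e he))) (by
        intro x y k u e he he'
        rw [← NatTrans.naturality_apply, ← unitSection_map]
        congr 2
        apply sheaf_ext_of_isPullback sq
        · rw [hmk₁, NatTrans.naturality_apply, hmk₁, op_comp, Functor.map_comp_apply]
        · rw [hmk₂, NatTrans.naturality_apply, hmk₂]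
          rfl)
  choose σ hσ₁ hσ₂ using hσ
  have σ_map : ∀ ⦃d x : D⦄ (k : x ⟶ d) (s : Y.obj.obj (op d)),
      σ x (Y.obj.map k.op s) = (σ d s).restrict (p.map k) := by
    intro d x k s
    have hb : (σ x (Y.obj.map k.op s)).base = X.obj.map (p.map k).op (σ d s).base := by
      rw [hσ₁, hσ₁]
      exact NatTrans.naturality_apply α.hom k.op s
    -- Uniqueness of extensions makes `σ` natural in `d`.
    refine SliceHom.ext_of_comp (K := K) Z.property hb fun y u e he he' ↦ ?_
    have e₁ : h.hom.app (op (p.obj y)) e = X.obj.map (p.map (u ≫ k)).op (σ d s).base := by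
      rw [he', p.map_comp, op_comp, Functor.map_comp_apply]
      rfl
    have e₂ := e₁
    rw [hσ₁] at e₂
    have e₃ := he
    rw [hσ₁] at e₃
    refine (hσ₂ x (Y.obj.map k.op s) u e e₃ he).trans ?_
    refine Eq.trans ?_ ((hσ₂ d s (u ≫ k) e e₂ e₁).symm.trans
      (SliceHom.app_congr _ (p.map_comp u k) rfl _ _))
    congr 2
    apply sheaf_ext_of_isPullback sq
    · rw [hmk₁, hmk₁, op_comp, Functor.map_comp_apply]
    · rw [hmk₂, hmk₂]
  let τ : Y ⟶ (p.sheafPushforwardContinuous (Type (max u v)) K J).obj (sliceHomSheaf h Z) :=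
    ⟨{ app := fun d ↦ TypeCat.ofHom fun s ↦ σ d.unop s
       naturality := fun d d' k ↦ ConcreteCategory.hom_ext _ _ (σ_map k.unop) }⟩
  obtain ⟨ψ, hψ⟩ := exists_uncurry sq' ((adj.homEquiv _ _).symm τ) (by
    apply hom_ext_unitSection adj
    intro d s
    rw [homEquiv_symm_unitSection]
    refine Eq.trans ?_ (hσ₁ d s)
    exact congrArg SliceHom.base (homEquiv_symm_unitSection adj τ s))
  refine ⟨ψ, hom_ext_unitSection adj fun d q ↦ ?_⟩
  obtain ⟨h₁, h₂⟩ := comparison_unitSection adj hκ₁ hκ₂ q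
  obtain ⟨s, hs⟩ : ∃ s : Y.obj.obj (op d), fst.hom.app (op d) q = s := ⟨_, rfl⟩
  obtain ⟨e, he⟩ : ∃ e : X'.obj.obj (op (p.obj d)), snd.hom.app (op d) q = e := ⟨_, rfl⟩
  rw [hs] at h₁
  replace h₂ := h₂.trans he
  have e₁ : h.hom.app (op (p.obj d)) e =
      X.obj.map (p.map (𝟙 d)).op (α.hom.app (op d) s) := by
    have e₀ := ConcreteCategory.congr_hom (congr_app (congrArg InducedCategory.Hom.hom sq.w)
      (op d)) q
    rw [p.map_id, op_id]
    refine Eq.trans ?_ (Functor.map_id_apply X.obj _ _).symm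
    rw [← he, ← hs]
    exact e₀.symm
  have e₂ := e₁
  rw [← hσ₁] at e₂
  have e₃ : ((adj.homEquiv _ _).symm τ).hom.app (op (p.obj d)) (a.hom.app (op (p.obj d))
      (κ.hom.app (op (p.obj d)) (unitSection adj q))) = σ d s := by
    rw [h₁]
    exact homEquiv_symm_unitSection adj τ _
  have e₄ : h.hom.app (op (p.obj d)) e = X.obj.map (𝟙 (p.obj d)).op (σ d s).base := by
    rw [e₂, p.map_id]
  -- At the identity of `d`, the chosen section of `P` over `(s, e)` is `q` itself, so the extension
  -- takes the value of `χ` there.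
  have e₅ : mk s (𝟙 d) e e₁ = q := by
    apply sheaf_ext_of_isPullback sq
    · refine (hmk₁ s (𝟙 d) e e₁).trans ?_
      rw [op_id, Functor.map_id_apply, hs]
    · exact (hmk₂ s (𝟙 d) e e₁).trans he.symm
  have e₆ := hσ₂ d s (𝟙 d) e e₁ e₂
  rw [e₅] at e₆
  refine (hψ (κ.hom.app (op (p.obj d)) (unitSection adj q)) (by rw [h₂, e₃]; exact e₄)).trans
    (Eq.trans ?_ e₆)
  refine (SliceHom.congr_app e₃ (𝟙 _) _ _ (by rw [h₂]; exact e₄)).trans ?_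
  exact SliceHom.app_congr _ (p.map_id d).symm h₂ _ _

/-- The Beck-Chevalley condition for the left adjoint of composition with a continuous local
fibration. -/
theorem isIso_comparison [IsLocalFibration p K J]
    (sq : IsPullback fst snd α ((p.sheafPushforwardContinuous (Type (max u v)) K J).map h))
    (sq' : IsPullback a b ((adj.homEquiv Y X).symm α) h) (hκ₁ : κ ≫ a = L.map fst)
    (hκ₂ : κ ≫ b = (adj.homEquiv P X').symm snd) : IsIso κ :=
  isIso_of_coyoneda_map_bijective κ fun _ ↦
    ⟨fun _ _ hψ ↦ comparison_comp_injective adj sq sq' hκ₁ hκ₂ hψ,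
      fun χ ↦ comparison_comp_surjective adj sq sq' hκ₁ hκ₂ χ⟩

end Square

end BeckChevalley

/-! ### Formal consequences of the Beck–Chevalley condition -/

section Formal

variable {F : Type t₁} [Category.{w₁} F] {E : Type t₂} [Category.{w₂} E]

theorem homEquiv_symm_ofNatIsoRight {L : F ⥤ E} {R R' : E ⥤ F} (adj : L ⊣ R) (ρ : R ≅ R')
    {Y : F} {X : E} (α : Y ⟶ R.obj X) :
    ((adj.ofNatIsoRight ρ).homEquiv Y X).symm (α ≫ ρ.hom.app X) =
      L.map α ≫ adj.counit.app X := by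
  refine (Adjunction.homEquiv_counit _ _ _ _).trans ?_
  have e : (adj.ofNatIsoRight ρ).counit.app X = L.map (ρ.inv.app X) ≫ adj.counit.app X := by
    simp [Adjunction.ofNatIsoRight]
  rw [e, ← Category.assoc, ← L.map_comp, Category.assoc, ρ.hom_inv_id_app, Category.comp_id]

variable [HasPullbacks F] [HasPullbacks E]

theorem isIso_sliceComparison {L : F ⥤ E} {R : E ⥤ F} (adj : L ⊣ R)
    (H : ∀ ⦃X' X : E⦄ (h : X' ⟶ X) ⦃Y : F⦄ (α : Y ⟶ R.obj X),
      IsIso (pullbackComparison adj h α)) {X' X : E} (h : X' ⟶ X) :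
    IsIso (sliceComparison adj h) := by
  rw [NatTrans.isIso_iff_isIso_app]
  intro α
  have : IsIso ((Over.forget X').map ((sliceComparison adj h).app α)) := H h α.hom
  exact isIso_of_reflects_iso _ (Over.forget X')

/-- A left adjoint satisfying the Beck-Chevalley condition is a fibration. -/
theorem isStreetFibration_of_isIso_pullbackComparison {L : F ⥤ E} {R : E ⥤ F} (adj : L ⊣ R)
    (H : ∀ ⦃X' X : E⦄ (h : X' ⟶ X) ⦃Y : F⦄ (α : Y ⟶ R.obj X),
      IsIso (pullbackComparison adj h α)) : IsStreetFibration L := by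
  intro c d f
  let η : d ⟶ R.obj (L.obj d) := adj.unit.app d
  have hη : L.map η ≫ adj.counit.app (L.obj d) = 𝟙 _ := adj.left_triangle_components d
  let fst := pullback.fst η (R.map f)
  let snd := pullback.snd η (R.map f)
  let σ : L.obj (pullback η (R.map f)) ⟶ c := L.map snd ≫ adj.counit.app c
  -- The transpose of the unit is the identity, so its pullback along `f` is `c` up to isomorphism;
  -- by Beck–Chevalley, so is `L` of the pullback of the unit.
  have hσ : IsIso σ := by
    have := H f η
    have : IsIso (L.map η ≫ adj.counit.app (L.obj d)) := by
      rw [hη]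
      infer_instance
    have e : pullbackComparison adj f η ≫ pullback.snd _ _ = σ :=
      pullbackComparison_snd adj f η
    rw [← e]
    infer_instance
  have hfst : L.map fst = σ ≫ f := by
    have e₁ : L.map fst = L.map (fst ≫ η) ≫ adj.counit.app (L.obj d) := by
      rw [L.map_comp, Category.assoc, hη, Category.comp_id]
    have e₂ : fst ≫ η = snd ≫ R.map f := pullback.condition
    rw [e₁, e₂]
    simp [σ]
  have hsnd : ∀ {a : F} (χ : a ⟶ pullback η (R.map f)),
      (adj.homEquiv _ _) (L.map χ ≫ σ) = χ ≫ snd := by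
    intro a χ
    rw [← Equiv.eq_symm_apply, Adjunction.homEquiv_counit]
    simp [σ]
  refine ⟨_, fst, asIso σ, hfst, ?_⟩
  -- An arrow from `a` to the pullback is a compatible pair of arrows to `d` and `R c`; the second
  -- transposes to `L a ⟶ c`, so it is dictated by `g ≫ σ`.
  refine ⟨fun {a} g φ hφ ↦ ?_⟩
  have hφ' : g ≫ L.map fst = L.map φ := IsHomLift.eq_of_isHomLift L (g ≫ L.map fst) φ
  have w : φ ≫ η = (adj.homEquiv _ _) (g ≫ σ) ≫ R.map f := by
    rw [← adj.homEquiv_naturality_right, Category.assoc, ← hfst, hφ']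
    simp [Adjunction.homEquiv_unit, η]
  have hlift : L.map (pullback.lift φ _ w) = g := by
    rw [← cancel_mono σ]
    apply (adj.homEquiv _ _).injective
    rw [hsnd]
    exact pullback.lift_snd _ _ _
  refine ⟨pullback.lift φ _ w, ⟨?_, pullback.lift_fst _ _ _⟩, ?_⟩
  · have : L.IsHomLift (L.map (pullback.lift φ _ w)) (pullback.lift φ _ w) := inferInstance
    rwa [hlift] at this
  · rintro χ ⟨hχ, hχ'⟩
    have e : g = L.map χ := IsHomLift.eq_of_isHomLift L g χ
    apply pullback.hom_ext
    · rw [pullback.lift_fst]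
      exact hχ'
    · rw [pullback.lift_snd, e]
      exact (hsnd χ).symm

end Formal

/-! ### Transfer to the geometric morphism `C_p` -/

section Main

variable {C : Type u} [Category.{v} C] {D : Type u} [Category.{v} D]
  (p : D ⥤ C) (K : GrothendieckTopology D) (J : GrothendieckTopology C)

/-- The inverse image of a continuous comorphism of sites is composition with it. -/
noncomputable def comorphismInverseImageIso [p.IsCocontinuous K J] [p.IsContinuous K J] :
    comorphismInverseImage p K J ≅ p.sheafPushforwardContinuous (Type (max u v)) K J :=
  (comorphismAdjunction p K J).leftAdjointUniq
    (p.sheafAdjunctionCocontinuous (Type (max u v)) K J)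

/-- Replacing `C_p^*` by the isomorphic restriction functor changes neither `L` nor the transposed
arrows, so the comparison arrow is the same. -/
theorem isIso_pullbackComparison_of_isLocalFibration [IsLocalFibration p K J]
    [p.IsContinuous K J] {L : Sh K ⥤ Sh J} (adj : L ⊣ comorphismInverseImage p K J)
    ⦃X' X : Sh J⦄ (h : X' ⟶ X) ⦃Y : Sh K⦄ (α : Y ⟶ (comorphismInverseImage p K J).obj X) :
    IsIso (pullbackComparison adj h α) := by
  let ρ := comorphismInverseImageIso p K J
  refine isIso_comparison (adj.ofNatIsoRight ρ) (h := h) (α := α ≫ ρ.hom.app X)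
    (fst := pullback.fst α ((comorphismInverseImage p K J).map h))
    (snd := pullback.snd α ((comorphismInverseImage p K J).map h) ≫ ρ.hom.app X')
    (a := pullback.fst _ h) (b := pullback.snd _ h) ?_ ?_
    (pullbackComparison_fst adj h α) ?_
  · exact (IsPullback.of_hasPullback α ((comorphismInverseImage p K J).map h)).of_iso
      (Iso.refl _) (Iso.refl _) (ρ.app X') (ρ.app X) (by simp) (by simp) (by simp) (by simp)
  · rw [homEquiv_symm_ofNatIsoRight]
    exact IsPullback.of_hasPullback _ _
  · rw [homEquiv_symm_ofNatIsoRight]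
    exact pullbackComparison_snd adj h α

end Main

end RelTopos

theorem proposition5p2p6 {C D : Type u} [Category.{v} C] [Category.{v} D]
    (J : GrothendieckTopology C) (K : GrothendieckTopology D) (p : D ⥤ C)
    [RelTopos.IsLocalFibration p K J] [p.IsContinuous K J] :
    (RelTopos.comorphismGeom p K J).IsLocallyConnected ∧
      Nonempty (p.sheafPullback (Type (max u v)) K J ⊣
        (RelTopos.comorphismGeom p K J).inverseImage) ∧
      ∀ (shriek : RelTopos.Sh K ⥤ RelTopos.Sh J),
        (shriek ⊣ (RelTopos.comorphismGeom p K J).inverseImage) →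
          RelTopos.IsStreetFibration shriek := by
  have adj : p.sheafPullback (Type (max u v)) K J ⊣
      (RelTopos.comorphismGeom p K J).inverseImage :=
    (p.sheafAdjunctionContinuous (Type (max u v)) K J).ofNatIsoRight
      (RelTopos.comorphismInverseImageIso p K J).symm
  exact ⟨⟨_, adj, fun _ _ h ↦ RelTopos.isIso_sliceComparison adj
      (RelTopos.isIso_pullbackComparison_of_isLocalFibration p K J adj) h⟩, ⟨adj⟩,
    fun _ adj' ↦ RelTopos.isStreetFibration_of_isIso_pullbackComparison adj'
      (RelTopos.isIso_pullbackComparison_of_isLocalFibration p K J adj')⟩
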